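/- Let $n\ge 2$, and let $\mathbb H^n$ be $n$-dimensional hyperbolic space with distance $d$. A convex body is a compact geodesically convex set $K\subset\mathbb H^n$ with non-empty interior. Its inradius $r(K)$ is the largest radius of a closed ball contained in $K$. A supporting hyperplane of $K$ is a hyperbolic hyperplane $H$ that meets $K$ and has $K$ in one of the two closed half-spaces bounded by $H$. The Lassak width of $K$ with respect to $H$ is $\max_{x\in K} d(x,H)$, and the minimal Lassak width $w(K)$ is the minimum of the Lassak widths of $K$ over all supporting hyperplanes $H$ of $K$. Then, for every real number $w>0$, $$ \inf\left\{r(K)\colon K\subset \mathbb H^n\text{ convex body, } w(K)\ge w\right\}=0 . $$ -/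

import Mathlib

noncomputable section

namespace PoincareBall

/-- Hyperbolic `n`-space in the Poincaré ball model: the open Euclidean unit ball of `ℝⁿ`.
Its topology is the subspace topology, which is also the topology of the hyperbolic distance. -/
abbrev Hyp (n : ℕ) : Type := {x : EuclideanSpace ℝ (Fin n) // ‖x‖ < 1}

variable {n : ℕ}

/-- The hyperbolic distance
`d(p, q) = arcosh (1 + 2‖p - q‖² / ((1 - ‖p‖²)(1 - ‖q‖²)))`. The (Euclidean) `dist` that the
subtype inherits is never used below. -/
def hdist (p q : Hyp n) : ℝ :=
  Real.arcosh (1 + 2 * ‖p.1 - q.1‖ ^ 2 / ((1 - ‖p.1‖ ^ 2) * (1 - ‖q.1‖ ^ 2)))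

/-- The closed hyperbolic ball `B(p, r)`. -/
def hball (p : Hyp n) (r : ℝ) : Set (Hyp n) := {q | hdist p q ≤ r}

/-- The geodesic segment `[x, y]`: the points lying metrically between `x` and `y`. (Any two points
of hyperbolic space are joined by a unique geodesic segment, and it consists of these points.) -/
def hsegment (x y : Hyp n) : Set (Hyp n) := {z | hdist x z + hdist z y = hdist x y}

/-- `X` contains the geodesic segment between any two of its points. -/
def HConvex (X : Set (Hyp n)) : Prop := ∀ x ∈ X, ∀ y ∈ X, hsegment x y ⊆ X

/-- Convex bodies: compact convex sets with non-empty interior. -/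
structure IsConvexBody (K : Set (Hyp n)) : Prop where
  isCompact : IsCompact K
  convex : HConvex K
  interior_nonempty : (interior K).Nonempty

/-- The hyperbolic hyperplane cut out by the linear hyperplane `u^⊥` (used with `u ≠ 0`). -/
def linHyperplane (u : EuclideanSpace ℝ (Fin n)) : Set (Hyp n) := {x | inner ℝ u x.1 = 0}

/-- The part of the ball on the Euclidean sphere with centre `c` and radius `r` (used for spheres
orthogonal to the unit sphere, that is, for `r > 0` and `‖c‖² = 1 + r²`). -/
def sphHyperplane (c : EuclideanSpace ℝ (Fin n)) (r : ℝ) : Set (Hyp n) := {x | ‖x.1 - c‖ = r}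

/-- `P` is one of the two closed half-spaces bounded by the hyperbolic hyperplane `H`. -/
def IsHalfSpaceOf (H P : Set (Hyp n)) : Prop :=
  (∃ u : EuclideanSpace ℝ (Fin n), u ≠ 0 ∧ H = linHyperplane u ∧
    (P = {x | inner ℝ u x.1 ≤ 0} ∨ P = {x | 0 ≤ inner ℝ u x.1})) ∨
  (∃ (c : EuclideanSpace ℝ (Fin n)) (r : ℝ), 0 < r ∧ ‖c‖ ^ 2 = 1 + r ^ 2 ∧
    H = sphHyperplane c r ∧ (P = {x | ‖x.1 - c‖ ≤ r} ∨ P = {x | r ≤ ‖x.1 - c‖}))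

/-- Hyperbolic hyperplanes: intersections of the open unit ball with a Euclidean hyperplane through
the origin, or with a Euclidean sphere orthogonal to the unit sphere. -/
def IsHyperplane (H : Set (Hyp n)) : Prop :=
  (∃ u : EuclideanSpace ℝ (Fin n), u ≠ 0 ∧ H = linHyperplane u) ∨
  (∃ (c : EuclideanSpace ℝ (Fin n)) (r : ℝ), 0 < r ∧ ‖c‖ ^ 2 = 1 + r ^ 2 ∧ H = sphHyperplane c r)

/-- `H` is a supporting hyperplane of `K`: a hyperplane that meets `K` and has `K` in one of the
closed half-spaces that it bounds. -/
def IsSupporting (H K : Set (Hyp n)) : Prop :=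
  IsHyperplane H ∧ (H ∩ K).Nonempty ∧ ∃ P, IsHalfSpaceOf H P ∧ K ⊆ P

/-- The hyperbolic distance of a point from a set. -/
def hdistSet (x : Hyp n) (H : Set (Hyp n)) : ℝ := sInf {t | ∃ y ∈ H, t = hdist x y}

/-- The Lassak width of `K` with respect to `H`: the maximal distance of the points of `K`
from `H`. -/
def lassakWidth (K H : Set (Hyp n)) : ℝ := sSup {t | ∃ x ∈ K, t = hdistSet x H}

/-- The minimal Lassak width `w(K)`: the minimum of the Lassak widths of `K` with respect to its
supporting hyperplanes. -/
def minLassakWidth (K : Set (Hyp n)) : ℝ :=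
  sInf {t | ∃ H, IsSupporting H K ∧ t = lassakWidth K H}

/-- The inradius `r(K)`: the largest radius of a ball contained in `K`. -/
def inradius (K : Set (Hyp n)) : ℝ := sSup {r | 0 < r ∧ ∃ p, hball p r ⊆ K}

end PoincareBall

end

/-! Take a slab around the hyperplane `f^⊥`, cut off by a ball of huge radius `L` about the origin.
It is thin, so its inradius is at most `s`: from any point one can move a distance `r` away from
`f^⊥` and reach distance at least `r` from it (`exists_sinh_le_inner`). Yet its Lassak width is
large, unlike in Euclidean space. The body contains a ball about the origin whose size depends only
on `s`, so every supporting hyperplane `H` stays a definite distance from the origin. Of the two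
tips at distance `L` in the directions `±e`, with `e` orthogonal to `f`, one lies on the side
pointing away from `H`; its distance to `H` tends to infinity with `L`, because geodesics diverge
(`timeCoord_le_mul_cosh_hdist`). Fix `s`, then let `L` grow. Computations use the hyperboloid model,
where `cosh_hdist` turns distances into Minkowski products. -/

noncomputable section

namespace PoincareBall

/-! ### Linear algebra of the Minkowski form. -/

section Minkowski

variable {E : Type*} [NormedAddCommGroup E] [InnerProductSpace ℝ E]

/-- A vector that is Minkowski-orthogonal to a unit timelike vector is spacelike. -/
lemma sq_add_sq_le_of_orthogonal {t w : ℝ} {v u : E} (ht : t ^ 2 = 1 + ‖v‖ ^ 2)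
    (h : w * t = inner ℝ u v) : w ^ 2 + w ^ 2 * ‖v‖ ^ 2 ≤ ‖u‖ ^ 2 * ‖v‖ ^ 2 := by
  have hc : (inner ℝ u v) ^ 2 ≤ (‖u‖ * ‖v‖) ^ 2 :=
    sq_le_sq' (neg_le_of_abs_le (abs_real_inner_le_norm u v)) (real_inner_le_norm u v)
  rw [← h] at hc
  nlinarith

lemma sq_le_norm_sq_of_orthogonal {t w : ℝ} {v u : E} (ht : t ^ 2 = 1 + ‖v‖ ^ 2)
    (h : w * t = inner ℝ u v) : w ^ 2 ≤ ‖u‖ ^ 2 := by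
  have := sq_add_sq_le_of_orthogonal ht h
  by_contra! hlt
  nlinarith [sq_nonneg w, sq_nonneg ‖v‖, sq_nonneg ‖u‖]

/-- Rigidity case: it turns equality in the triangle inequality into a linear identity in
`exists_combination_of_mem_hsegment`. -/
lemma eq_zero_of_orthogonal_of_null {t w : ℝ} {v u : E} (ht : t ^ 2 = 1 + ‖v‖ ^ 2)
    (h : w * t = inner ℝ u v) (h0 : w ^ 2 = ‖u‖ ^ 2) : w = 0 ∧ u = 0 := by
  have := sq_add_sq_le_of_orthogonal ht h
  have hw : w ^ 2 = 0 := le_antisymm (by rw [← h0] at this; linarith) (sq_nonneg w)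
  have hu : ‖u‖ ^ 2 = 0 := h0 ▸ hw
  exact ⟨by simpa using hw, by simpa using hu⟩

/-- The reversed Cauchy–Schwarz inequality for the Minkowski form. -/
lemma sq_sub_norm_sq_le {t a : ℝ} {v u : E} (ht : t ^ 2 = 1 + ‖v‖ ^ 2) :
    a ^ 2 - ‖u‖ ^ 2 ≤ (a * t - inner ℝ u v) ^ 2 := by
  -- Subtracting `k • (t, v)` from `(a, u)` leaves the component orthogonal to `(t, v)`, which is
  -- spacelike.
  set k := a * t - inner ℝ u v with hk
  have h := sq_le_norm_sq_of_orthogonal (w := a - k * t) (u := u - k • v) ht (by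
    rw [inner_sub_left, real_inner_smul_left, real_inner_self_eq_norm_sq]
    linear_combination (-k) * ht - hk)
  rw [norm_sub_sq_real, real_inner_smul_right, norm_smul, mul_pow, Real.norm_eq_abs, sq_abs] at h
  nlinarith

end Minkowski

variable {n : ℕ}

/-! ### Hyperboloid coordinates and geodesic segments. -/

/-- The timelike coordinate of a point in the hyperboloid model. -/
def timeCoord (p : Hyp n) : ℝ := (1 + ‖p.1‖ ^ 2) / (1 - ‖p.1‖ ^ 2)

/-- The spacelike coordinates of a point in the hyperboloid model. -/
def spaceCoord (p : Hyp n) : EuclideanSpace ℝ (Fin n) := (2 / (1 - ‖p.1‖ ^ 2)) • p.1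

lemma one_sub_norm_sq_pos (p : Hyp n) : 0 < 1 - ‖p.1‖ ^ 2 := by
  nlinarith [p.2, norm_nonneg p.1]

lemma norm_spaceCoord_sq (p : Hyp n) :
    ‖spaceCoord p‖ ^ 2 = (2 / (1 - ‖p.1‖ ^ 2)) ^ 2 * ‖p.1‖ ^ 2 := by
  rw [spaceCoord, norm_smul, mul_pow, Real.norm_eq_abs, sq_abs]

lemma timeCoord_sq (p : Hyp n) : timeCoord p ^ 2 = 1 + ‖spaceCoord p‖ ^ 2 := by
  have := one_sub_norm_sq_pos p
  rw [norm_spaceCoord_sq, timeCoord]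
  field_simp
  ring

lemma one_le_timeCoord (p : Hyp n) : 1 ≤ timeCoord p := by
  rw [timeCoord, one_le_div (one_sub_norm_sq_pos p)]
  nlinarith [sq_nonneg ‖p.1‖]

lemma one_le_cosh_arg (p q : Hyp n) :
    1 ≤ 1 + 2 * ‖p.1 - q.1‖ ^ 2 / ((1 - ‖p.1‖ ^ 2) * (1 - ‖q.1‖ ^ 2)) := by
  have := one_sub_norm_sq_pos p
  have := one_sub_norm_sq_pos q
  have : 0 ≤ 2 * ‖p.1 - q.1‖ ^ 2 / ((1 - ‖p.1‖ ^ 2) * (1 - ‖q.1‖ ^ 2)) := by positivity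
  linarith

lemma cosh_hdist (p q : Hyp n) :
    Real.cosh (hdist p q)
      = timeCoord p * timeCoord q - inner ℝ (spaceCoord p) (spaceCoord q) := by
  have hp := one_sub_norm_sq_pos p
  have hq := one_sub_norm_sq_pos q
  rw [hdist, Real.cosh_arcosh (one_le_cosh_arg p q), norm_sub_sq_real, timeCoord, timeCoord,
    spaceCoord, spaceCoord, real_inner_smul_left, real_inner_smul_right]
  field_simp
  ring

lemma hdist_nonneg (p q : Hyp n) : 0 ≤ hdist p q :=
  Real.arcosh_nonneg (one_le_cosh_arg p q)

lemma le_hdist_of_cosh_le {a : ℝ} {p q : Hyp n} (ha : 0 ≤ a)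
    (h : Real.cosh a ≤ timeCoord p * timeCoord q - inner ℝ (spaceCoord p) (spaceCoord q)) :
    a ≤ hdist p q := by
  rw [← cosh_hdist, Real.cosh_le_cosh, abs_of_nonneg ha, abs_of_nonneg (hdist_nonneg p q)] at h
  exact h

/-- Every point of the upper sheet of the hyperboloid comes from a point of the ball. -/
lemma exists_coords {t : ℝ} {v : EuclideanSpace ℝ (Fin n)} (ht : 0 < t)
    (h : t ^ 2 = 1 + ‖v‖ ^ 2) : ∃ p : Hyp n, timeCoord p = t ∧ spaceCoord p = v := by
  have hn : ‖(1 + t)⁻¹ • v‖ ^ 2 = (t - 1) / (t + 1) := by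
    rw [norm_smul, mul_pow, Real.norm_eq_abs, sq_abs, eq_sub_of_add_eq' h.symm]
    field_simp
    ring
  have hlt : ‖(1 + t)⁻¹ • v‖ < 1 := by
    have : ‖(1 + t)⁻¹ • v‖ ^ 2 < 1 ^ 2 := by
      rw [hn, one_pow, div_lt_one (by linarith)]
      linarith
    exact lt_of_pow_lt_pow_left₀ 2 zero_le_one this
  have h1 : 1 - (t - 1) / (t + 1) = 2 / (t + 1) := by
    field_simp
    ring
  refine ⟨⟨(1 + t)⁻¹ • v, hlt⟩, ?_, ?_⟩
  · rw [timeCoord, hn, h1]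
    field_simp
    ring
  · rw [spaceCoord, hn, h1, smul_smul]
    have : 2 / (2 / (t + 1)) * (1 + t)⁻¹ = 1 := by
      field_simp
      ring
    rw [this, one_smul]

lemma continuous_timeCoord : Continuous (timeCoord : Hyp n → ℝ) := by
  unfold timeCoord
  exact Continuous.div (by fun_prop) (by fun_prop) fun p => (one_sub_norm_sq_pos p).ne'

lemma continuous_spaceCoord : Continuous (spaceCoord : Hyp n → EuclideanSpace ℝ (Fin n)) := by
  unfold spaceCoord
  exact (Continuous.div (by fun_prop) (by fun_prop) fun p => (one_sub_norm_sq_pos p).ne').smul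
    continuous_subtype_val

/-- Makes the coefficients of a point on a segment sum to at most 1. -/
lemma sinh_add_sinh_le {a b : ℝ} (ha : 0 ≤ a) (hb : 0 ≤ b) :
    Real.sinh a + Real.sinh b ≤ Real.sinh (a + b) := by
  rw [Real.sinh_add]
  nlinarith [Real.one_le_cosh a, Real.one_le_cosh b, Real.sinh_nonneg_iff.2 ha,
    Real.sinh_nonneg_iff.2 hb]

/-- A point of a geodesic segment is a combination of the end points in the hyperboloid model. -/
lemma exists_combination_of_mem_hsegment {x y z : Hyp n} (hz : z ∈ hsegment x y) :
    ∃ a b : ℝ, 0 ≤ a ∧ 0 ≤ b ∧ a + b ≤ 1 ∧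
      timeCoord z = a * timeCoord x + b * timeCoord y ∧
      spaceCoord z = a • spaceCoord x + b • spaceCoord y := by
  have hz' : hdist x z + hdist z y = hdist x y := hz
  set t₁ := hdist x z with ht₁
  set t₂ := hdist z y with ht₂
  have h₁ : 0 ≤ t₁ := hdist_nonneg x z
  have h₂ : 0 ≤ t₂ := hdist_nonneg z y
  have cxz := cosh_hdist x z
  have czy := cosh_hdist z y
  have cxy := cosh_hdist x y
  rw [← hz', Real.cosh_add] at cxy
  rw [← ht₁] at cxz
  rw [← ht₂] at czy
  have sx := timeCoord_sq x
  have sy := timeCoord_sq y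
  have sz := timeCoord_sq z
  have q₁ := Real.cosh_sq t₁
  have q₂ := Real.cosh_sq t₂
  have hS := Real.sinh_add t₁ t₂
  have hle := sinh_add_sinh_le h₁ h₂
  have n₁ := Real.sinh_nonneg_iff.2 h₁
  have n₂ := Real.sinh_nonneg_iff.2 h₂
  rcases (add_nonneg h₁ h₂).eq_or_lt with h0 | hpos
  · -- all three points coincide
    have e₁ : t₁ = 0 := by linarith
    rw [e₁, Real.cosh_zero] at cxz
    have key := eq_zero_of_orthogonal_of_null (w := timeCoord x - timeCoord z)
      (u := spaceCoord x - spaceCoord z) sz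
      (by rw [inner_sub_left, real_inner_self_eq_norm_sq]; linarith)
      (by rw [norm_sub_sq_real]; linarith)
    exact ⟨1, 0, zero_le_one, le_rfl, by norm_num, by linarith [key.1],
      by simpa using (sub_eq_zero.1 key.2).symm⟩
  · set S := Real.sinh (t₁ + t₂) with hSdef
    have hSpos : 0 < S := Real.sinh_pos_iff.2 hpos
    -- The expected identity is `sinh (t₁ + t₂) z = sinh t₂ x + sinh t₁ y`; the difference of its
    -- sides is null and orthogonal to `z`, hence zero.
    have key := eq_zero_of_orthogonal_of_null
      (w := S * timeCoord z - Real.sinh t₂ * timeCoord x - Real.sinh t₁ * timeCoord y)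
      (u := S • spaceCoord z - Real.sinh t₂ • spaceCoord x - Real.sinh t₁ • spaceCoord y) sz
      (by
        rw [inner_sub_left, inner_sub_left, real_inner_smul_left, real_inner_smul_left,
          real_inner_smul_left, real_inner_self_eq_norm_sq,
          real_inner_comm (spaceCoord z) (spaceCoord y)]
        linear_combination S * sz + Real.sinh t₂ * cxz + Real.sinh t₁ * czy + hS)
      (by
        rw [norm_sub_sq_real, norm_sub_sq_real, inner_sub_left]
        simp only [real_inner_smul_left, real_inner_smul_right, norm_smul, mul_pow,
          Real.norm_eq_abs, sq_abs, real_inner_comm (spaceCoord x) (spaceCoord z)]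
        linear_combination S ^ 2 * sz + Real.sinh t₂ ^ 2 * sx + Real.sinh t₁ ^ 2 * sy
          + 2 * S * Real.sinh t₂ * cxz + 2 * S * Real.sinh t₁ * czy
          - 2 * Real.sinh t₁ * Real.sinh t₂ * cxy
          + (S - (Real.sinh t₁ * Real.cosh t₂ + Real.cosh t₁ * Real.sinh t₂)) * hS
          - Real.sinh t₁ ^ 2 * q₂ - Real.sinh t₂ ^ 2 * q₁)
    refine ⟨Real.sinh t₂ / S, Real.sinh t₁ / S, by positivity, by positivity, ?_, ?_, ?_⟩
    · rw [← add_div, div_le_one hSpos]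
      linarith
    · field_simp
      linarith [key.1]
    · have h := key.2
      rw [sub_sub, sub_eq_zero] at h
      rw [div_eq_inv_mul, div_eq_inv_mul, ← smul_smul, ← smul_smul, ← smul_add, ← h, smul_smul,
        inv_mul_cancel₀ hSpos.ne', one_smul]

/-! ### The thin bodies. -/

/-- The points of the hyperbolic ball with centre the origin and radius `L` whose hyperbolic
distance from the hyperplane `f^⊥` is at most `arsinh s`. -/
def thinBody (f : EuclideanSpace ℝ (Fin n)) (L s : ℝ) : Set (Hyp n) :=
  {x | timeCoord x ≤ Real.cosh L ∧ |inner ℝ f (spaceCoord x)| ≤ s}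

lemma hconvex_thinBody (f : EuclideanSpace ℝ (Fin n)) (L s : ℝ) : HConvex (thinBody f L s) := by
  rintro x ⟨hx₁, hx₂⟩ y ⟨hy₁, hy₂⟩ z hz
  obtain ⟨a, b, ha, hb, hab, ht, hv⟩ := exists_combination_of_mem_hsegment hz
  have comb : ∀ {u v c : ℝ}, 0 ≤ c → u ≤ c → v ≤ c → a * u + b * v ≤ c := by
    intro u v c hc hu hv
    nlinarith [mul_le_mul_of_nonneg_left hu ha, mul_le_mul_of_nonneg_left hv hb]
  refine ⟨?_, ?_⟩
  · rw [ht]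
    exact comb (Real.cosh_pos L).le hx₁ hy₁
  · rw [hv, inner_add_right, real_inner_smul_right, real_inner_smul_right]
    refine (abs_add_le _ _).trans ?_
    rw [abs_mul, abs_mul, abs_of_nonneg ha, abs_of_nonneg hb]
    exact comb ((abs_nonneg _).trans hx₂) hx₂ hy₂

lemma isCompact_thinBody (f : EuclideanSpace ℝ (Fin n)) (L s : ℝ) :
    IsCompact (thinBody f L s) := by
  set T := Real.cosh L with hT
  have hT1 : 1 ≤ T := Real.one_le_cosh L
  -- The Euclidean radius `tanh (L / 2)` of the hyperbolic ball of radius `L`.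
  set ρ := √((T - 1) / (T + 1)) with hρ
  have hρ1 : ρ < 1 := by
    rw [hρ, Real.sqrt_lt' one_pos, one_pow, div_lt_one (by linarith)]
    linarith
  have hball : IsCompact ((Subtype.val : Hyp n → _) ⁻¹' Metric.closedBall 0 ρ) := by
    have hind : Topology.IsInducing (Subtype.val : Hyp n → EuclideanSpace ℝ (Fin n)) := ⟨rfl⟩
    rw [hind.isCompact_preimage_iff]
    · exact isCompact_closedBall _ _
    intro x hx
    exact ⟨⟨x, lt_of_le_of_lt (mem_closedBall_zero_iff.1 hx) hρ1⟩, rfl⟩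
  refine hball.of_isClosed_subset ?_ ?_
  · have h₁ : IsClosed {x : Hyp n | timeCoord x ≤ T} :=
      isClosed_le continuous_timeCoord continuous_const
    have h₂ : IsClosed {x : Hyp n | |inner ℝ f (spaceCoord x)| ≤ s} :=
      isClosed_le (continuous_const.inner continuous_spaceCoord).abs continuous_const
    exact h₁.inter h₂
  · rintro x ⟨hx, -⟩
    have := one_sub_norm_sq_pos x
    rw [Set.mem_preimage, mem_closedBall_zero_iff, hρ]
    refine Real.le_sqrt_of_sq_le ?_
    rw [timeCoord, div_le_iff₀ this] at hx
    rw [le_div_iff₀ (by linarith)]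
    linarith

/-- The body contains a Euclidean ball around the origin. -/
lemma mem_thinBody_of_norm_le {f : EuclideanSpace ℝ (Fin n)} (hf : ‖f‖ = 1) {L s : ℝ}
    (hs : s ≤ 1) (hL : 2 ≤ Real.cosh L) {x : Hyp n} (hx : ‖x.1‖ ≤ s / 4) :
    x ∈ thinBody f L s := by
  have h0 := norm_nonneg x.1
  have hpos := one_sub_norm_sq_pos x
  have hsq : ‖x.1‖ ^ 2 ≤ 1 / 16 := by nlinarith
  refine ⟨?_, ?_⟩
  · rw [timeCoord, div_le_iff₀ hpos]
    nlinarith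
  · rw [spaceCoord, real_inner_smul_right, abs_mul, abs_of_pos (by positivity), div_mul_eq_mul_div,
      div_le_iff₀ hpos]
    have := abs_real_inner_le_norm f x.1
    rw [hf, one_mul] at this
    nlinarith

lemma isConvexBody_thinBody {f : EuclideanSpace ℝ (Fin n)} (hf : ‖f‖ = 1) {L s : ℝ}
    (hs₀ : 0 < s) (hs : s ≤ 1) (hL : 2 ≤ Real.cosh L) : IsConvexBody (thinBody f L s) where
  isCompact := isCompact_thinBody f L s
  convex := hconvex_thinBody f L s
  interior_nonempty := by
    refine ⟨⟨0, by simp⟩, mem_interior.2 ⟨{x | ‖x.1‖ < s / 4}, fun x hx =>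
      mem_thinBody_of_norm_le hf hs hL (le_of_lt hx), isOpen_lt (by fun_prop) continuous_const, ?_⟩⟩
    simpa using hs₀

/-! ### The inradius. -/

/-- Every point can be pushed away from the hyperplane `f^⊥` within the ball
of radius `r` around it, to distance at least `r`. -/
lemma exists_sinh_le_inner {f : EuclideanSpace ℝ (Fin n)} (hf : ‖f‖ = 1) {r : ℝ} (hr : 0 ≤ r)
    (p : Hyp n) (hp : 0 ≤ inner ℝ f (spaceCoord p)) :
    ∃ q ∈ hball p r, Real.sinh r ≤ inner ℝ f (spaceCoord q) := by
  set a := inner ℝ f (spaceCoord p) with ha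
  -- The tangential part of `f` at `p` is `f + a p`, of length `m`. The point `q` is reached after
  -- time `r` along the geodesic in this direction: `cosh r p + (sinh r / m) (f + a p)`.
  set m := √(1 + a ^ 2) with hm
  have hmsq : m ^ 2 = 1 + a ^ 2 := Real.sq_sqrt (by positivity)
  have hm1 : 1 ≤ m := Real.one_le_sqrt.2 (by nlinarith)
  set c := Real.cosh r with hc
  set k := Real.sinh r / m with hk
  have hkm : k * m = Real.sinh r := div_mul_cancel₀ _ (by positivity)
  have hk0 : 0 ≤ k := div_nonneg (Real.sinh_nonneg_iff.2 hr) (by positivity)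
  have hcs := Real.cosh_sq r
  have hkk : k ^ 2 * (1 + a ^ 2) = c ^ 2 - 1 := by
    rw [← hmsq, ← mul_pow, hkm, hc]; linarith
  have hc0 : 0 < c := Real.cosh_pos r
  have htp := timeCoord_sq p
  have ht0 := one_le_timeCoord p
  have hff : inner ℝ f f = (1 : ℝ) := by rw [real_inner_self_eq_norm_sq, hf, one_pow]
  have hcomm : inner ℝ (spaceCoord p) f = a := by rw [real_inner_comm]
  obtain ⟨q, hqt, hqv⟩ := exists_coords (n := n) (t := (c + k * a) * timeCoord p)
    (v := (c + k * a) • spaceCoord p + k • f) (by positivity) (by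
      rw [norm_add_sq_real, real_inner_smul_left, real_inner_smul_right, hcomm, norm_smul,
        norm_smul, hf, mul_one, mul_pow, mul_pow, Real.norm_eq_abs, Real.norm_eq_abs, sq_abs, sq_abs]
      linear_combination (c + k * a) ^ 2 * htp - hkk)
  refine ⟨q, ?_, ?_⟩
  · have h := cosh_hdist p q
    rw [hqt, hqv, inner_add_right, real_inner_smul_right, real_inner_smul_right, hcomm,
      real_inner_self_eq_norm_sq] at h
    have h' : Real.cosh (hdist p q) = Real.cosh r := by
      rw [h]
      linear_combination (c + k * a) * htp
    have := Real.cosh_le_cosh.1 h'.le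
    rwa [abs_of_nonneg (hdist_nonneg p q), abs_of_nonneg hr] at this
  · rw [hqv, inner_add_right, real_inner_smul_right, real_inner_smul_right, hff, ← ha]
    have : (c + k * a) * a + k * 1 = c * a + (k * m) * m := by linear_combination (-k) * hmsq
    rw [this, hkm]
    nlinarith [Real.sinh_nonneg_iff.2 hr, mul_nonneg hc0.le hp]

lemma inradius_thinBody_le {f : EuclideanSpace ℝ (Fin n)} (hf : ‖f‖ = 1) {L s : ℝ}
    (hs : 0 ≤ s) : inradius (thinBody f L s) ≤ s := by
  refine Real.sSup_le ?_ hs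
  rintro r ⟨hr, p, hp⟩
  refine (Real.self_le_sinh_iff.2 hr.le).trans ?_
  rcases le_total 0 (inner ℝ f (spaceCoord p)) with h | h
  · obtain ⟨q, hq, hle⟩ := exists_sinh_le_inner hf hr.le p h
    exact hle.trans ((le_abs_self _).trans (hp hq).2)
  · obtain ⟨q, hq, hle⟩ := exists_sinh_le_inner (f := -f) (by rwa [norm_neg]) hr.le p
      (by rw [inner_neg_left]; linarith)
    rw [inner_neg_left] at hle
    exact hle.trans ((neg_le_abs _).trans (hp hq).2)

lemma inradius_nonneg (K : Set (Hyp n)) : 0 ≤ inradius K :=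
  Real.sSup_nonneg fun _ hr => hr.1.le

/-! ### Supporting hyperplanes and the Lassak width. -/

/-- The squared Euclidean distance from the centre of a sphere orthogonal to the unit sphere. -/
lemma norm_sub_sq_eq {c : EuclideanSpace ℝ (Fin n)} {r : ℝ} (hc : ‖c‖ ^ 2 = 1 + r ^ 2) (x : Hyp n) :
    ‖x.1 - c‖ ^ 2
      = r ^ 2 + (1 - ‖x.1‖ ^ 2) * (timeCoord x - inner ℝ (spaceCoord x) c) := by
  have := one_sub_norm_sq_pos x
  rw [norm_sub_sq_real, hc, timeCoord, spaceCoord, real_inner_smul_left]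
  field_simp
  ring

/-- The hyperplane is the Minkowski complement of the spacelike vector `(1, c)`, whose square is `r
^ 2`. -/
lemma mem_sphHyperplane_iff {c : EuclideanSpace ℝ (Fin n)} {r : ℝ} (hr : 0 < r)
    (hc : ‖c‖ ^ 2 = 1 + r ^ 2) (x : Hyp n) :
    x ∈ sphHyperplane c r ↔ timeCoord x = inner ℝ (spaceCoord x) c := by
  have hpos := one_sub_norm_sq_pos x
  rw [sphHyperplane, Set.mem_ofPred_eq, ← sq_eq_sq₀ (norm_nonneg _) hr.le, norm_sub_sq_eq hc,
    add_eq_left, mul_eq_zero, or_iff_right hpos.ne', sub_eq_zero]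

lemma le_norm_sub_iff {c : EuclideanSpace ℝ (Fin n)} {r : ℝ} (hr : 0 < r)
    (hc : ‖c‖ ^ 2 = 1 + r ^ 2) (x : Hyp n) :
    r ≤ ‖x.1 - c‖ ↔ inner ℝ (spaceCoord x) c ≤ timeCoord x := by
  have hpos := one_sub_norm_sq_pos x
  rw [← sq_le_sq₀ hr.le (norm_nonneg _), norm_sub_sq_eq hc, le_add_iff_nonneg_right,
    mul_nonneg_iff_of_pos_left hpos, sub_nonneg]

/-- The point at distance `L` from the origin in the direction `e` lies in the body. -/
lemma exists_tip {e f : EuclideanSpace ℝ (Fin n)} (he : ‖e‖ = 1) (hef : inner ℝ f e = (0 : ℝ))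
    {L s : ℝ} (hs : 0 ≤ s) : ∃ p ∈ thinBody f L s, timeCoord p = Real.cosh L ∧
      spaceCoord p = Real.sinh L • e := by
  obtain ⟨p, ht, hv⟩ := exists_coords (n := n) (t := Real.cosh L) (v := Real.sinh L • e)
    (Real.cosh_pos L) (by
      rw [norm_smul, mul_pow, Real.norm_eq_abs, sq_abs, he, Real.cosh_sq]; ring)
  refine ⟨p, ⟨ht.le, ?_⟩, ht, hv⟩
  rw [hv, real_inner_smul_right, hef, mul_zero, abs_zero]
  exact hs

/-- Needed because the infimum of an empty set of widths would be 0. The witness is tangent at a tip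
to the ball of radius `L`. -/
lemma exists_isSupporting_thinBody {e f : EuclideanSpace ℝ (Fin n)} (he : ‖e‖ = 1)
    (hef : inner ℝ f e = (0 : ℝ)) {L s : ℝ} (hs : 0 ≤ s) (hL : 0 < L) :
    ∃ H, IsSupporting H (thinBody f L s) := by
  have hS : 0 < Real.sinh L := Real.sinh_pos_iff.2 hL
  have hC := Real.cosh_pos L
  have hCS := Real.cosh_sq L
  set c : EuclideanSpace ℝ (Fin n) := (Real.cosh L / Real.sinh L) • e with hcdef
  set r := 1 / Real.sinh L with hrdef
  have hr : 0 < r := by positivity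
  have hcn : ‖c‖ = Real.cosh L / Real.sinh L := by
    rw [hcdef, norm_smul, he, mul_one, Real.norm_eq_abs, abs_of_pos (by positivity)]
  have hc : ‖c‖ ^ 2 = 1 + r ^ 2 := by
    rw [hcn, hrdef]
    field_simp
    linarith
  refine ⟨sphHyperplane c r, Or.inr ⟨c, r, hr, hc, rfl⟩, ?_,
    {x | r ≤ ‖x.1 - c‖}, Or.inr ⟨c, r, hr, hc, rfl, Or.inr rfl⟩, ?_⟩
  · obtain ⟨p, hp, ht, hv⟩ := exists_tip he hef (L := L) hs
    refine ⟨p, (mem_sphHyperplane_iff hr hc p).2 ?_, hp⟩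
    rw [ht, hv, hcdef, real_inner_smul_left, real_inner_smul_right, real_inner_self_eq_norm_sq, he]
    field_simp
  · rintro x ⟨hx, -⟩
    refine (le_norm_sub_iff hr hc x).2 ((real_inner_le_norm _ _).trans ?_)
    have h1 := one_le_timeCoord x
    have hsq := timeCoord_sq x
    refine le_of_sq_le_sq ?_ (by linarith)
    rw [mul_pow, hcn, div_pow, mul_div_assoc', div_le_iff₀ (by positivity)]
    nlinarith

/-- Needed because `sSup` of an unbounded set is 0; any bound would do. -/
lemma bddAbove_hdistSet_thinBody {f : EuclideanSpace ℝ (Fin n)} {L s : ℝ} {H : Set (Hyp n)}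
    (hH : (H ∩ thinBody f L s).Nonempty) :
    BddAbove {t | ∃ x ∈ thinBody f L s, t = hdistSet x H} := by
  obtain ⟨y, hyH, hy⟩ := hH
  refine ⟨2 * Real.cosh L ^ 2, ?_⟩
  rintro _ ⟨x, hx, rfl⟩
  have hle : hdistSet x H ≤ hdist x y :=
    csInf_le ⟨0, by rintro _ ⟨z, -, rfl⟩; exact hdist_nonneg x z⟩ ⟨y, hyH, rfl⟩
  refine hle.trans ?_
  have hid : hdist x y ≤ Real.cosh (hdist x y) :=
    (Real.self_le_sinh_iff.2 (hdist_nonneg x y)).trans (Real.sinh_lt_cosh _).le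
  refine hid.trans ?_
  rw [cosh_hdist]
  have hin := neg_le_of_abs_le (abs_real_inner_le_norm (spaceCoord x) (spaceCoord y))
  have hb : ∀ z : Hyp n, ‖spaceCoord z‖ ≤ timeCoord z := fun z =>
    le_of_sq_le_sq (by linarith [timeCoord_sq z]) (by linarith [one_le_timeCoord z])
  have h1 := mul_le_mul (hb x) (hb y) (norm_nonneg _) (by linarith [one_le_timeCoord x])
  have h2 := mul_le_mul hx.1 hy.1 (by linarith [one_le_timeCoord y]) (Real.cosh_pos L).le
  nlinarith

/-- A lower bound for the distance from a point on the same side as the origin. -/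
lemma timeCoord_le_mul_cosh_hdist {c : EuclideanSpace ℝ (Fin n)} {r : ℝ} (hr : 0 < r)
    (hc : ‖c‖ ^ 2 = 1 + r ^ 2) {p y : Hyp n} (hp : inner ℝ (spaceCoord p) c ≤ 0)
    (hy : y ∈ sphHyperplane c r) : timeCoord p ≤ r * Real.cosh (hdist p y) := by
  rw [mem_sphHyperplane_iff hr hc] at hy
  have h1 := one_le_timeCoord p
  have hge := (Real.cosh_pos (hdist p y)).le
  rw [cosh_hdist] at hge ⊢
  -- With this `b`, `p + b (1, c)` is the orthogonal projection of `p` to the hyperplane's linear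
  -- span. Its product with `y` is that of `p`, so reversed Cauchy–Schwarz gives `1 + b² r² ≤ cosh²
  -- d(p, y)`, while `hp` gives `b r² ≥ timeCoord p`.
  set b := (timeCoord p - inner ℝ (spaceCoord p) c) / r ^ 2 with hb
  have hbr : b * r ^ 2 = timeCoord p - inner ℝ (spaceCoord p) c :=
    div_mul_cancel₀ _ (by positivity)
  have key := sq_sub_norm_sq_le (a := timeCoord p + b) (u := spaceCoord p + b • c) (timeCoord_sq y)
  rw [norm_add_sq_real, real_inner_smul_right, norm_smul, mul_pow, Real.norm_eq_abs, sq_abs, hc,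
    inner_add_left, real_inner_smul_left, real_inner_comm (spaceCoord y) c] at key
  rw [← hy] at key
  have hsq : timeCoord p ^ 2
      ≤ (r * (timeCoord p * timeCoord y - inner ℝ (spaceCoord p) (spaceCoord y))) ^ 2 := by
    have hid : (timeCoord p + b) * timeCoord y
        - (inner ℝ (spaceCoord p) (spaceCoord y) + b * timeCoord y)
        = timeCoord p * timeCoord y - inner ℝ (spaceCoord p) (spaceCoord y) := by ring
    rw [hid] at key
    have key' := mul_le_mul_of_nonneg_left key (sq_nonneg r)
    rw [mul_pow]
    have hA : timeCoord p ^ 2 ≤ (b * r ^ 2) ^ 2 := by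
      rw [hbr]
      gcongr
      linarith
    have htp := timeCoord_sq p
    have hval : (timeCoord p + b) ^ 2
        - (‖spaceCoord p‖ ^ 2 + 2 * (b * inner ℝ (spaceCoord p) c) + b ^ 2 * (1 + r ^ 2))
        = 1 + b * (b * r ^ 2) := by
      linear_combination htp - 2 * b * hbr
    rw [hval] at key'
    nlinarith [sq_nonneg r]
  exact abs_le_of_sq_le_sq' hsq (mul_nonneg hr.le hge) |>.2

/-- A supporting hyperplane cannot pass close to the origin. -/
lemma exists_sphere_of_isSupporting {f : EuclideanSpace ℝ (Fin n)} (hf : ‖f‖ = 1) {L s : ℝ}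
    (hs₀ : 0 < s) (hs : s ≤ 1) (hL : 2 ≤ Real.cosh L) {H : Set (Hyp n)}
    (hH : IsSupporting H (thinBody f L s)) :
    ∃ (c : EuclideanSpace ℝ (Fin n)) (r : ℝ), 0 < r ∧ ‖c‖ ^ 2 = 1 + r ^ 2 ∧
      H = sphHyperplane c r ∧ r * (s / 4) ≤ 1 := by
  obtain ⟨-, -, P, hP, hK⟩ := hH
  have hmem : ∀ v : EuclideanSpace ℝ (Fin n), v ≠ 0 → ∀ k : ℝ, |k| = 1 →
      ∃ x ∈ P, x.1 = (k * (s / 4) / ‖v‖) • v := by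
    intro v hv k hk
    have hn : ‖(k * (s / 4) / ‖v‖) • v‖ = s / 4 := by
      rw [norm_smul, Real.norm_eq_abs, abs_div, abs_mul, hk, abs_norm,
        div_mul_cancel₀ _ (norm_ne_zero_iff.2 hv), one_mul, abs_of_pos (by positivity)]
    exact ⟨⟨_, by rw [hn]; linarith⟩, hK (mem_thinBody_of_norm_le hf hs hL hn.le), rfl⟩
  rcases hP with ⟨u, hu, -, h⟩ | ⟨c, r, hr, hc, hHc, h⟩
  · exfalso
    have hu' := norm_pos_iff.2 hu
    rcases h with h | h
    · obtain ⟨x, hx, hxv⟩ := hmem u hu 1 (by simp)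
      rw [h, Set.mem_ofPred_eq, hxv, real_inner_smul_right, real_inner_self_eq_norm_sq] at hx
      have : 0 < 1 * (s / 4) / ‖u‖ * ‖u‖ ^ 2 := by positivity
      linarith
    · obtain ⟨x, hx, hxv⟩ := hmem u hu (-1) (by simp)
      rw [h, Set.mem_ofPred_eq, hxv, real_inner_smul_right, real_inner_self_eq_norm_sq] at hx
      have : 0 < 1 * (s / 4) / ‖u‖ * ‖u‖ ^ 2 := by positivity
      have e : -1 * (s / 4) / ‖u‖ * ‖u‖ ^ 2 = -(1 * (s / 4) / ‖u‖ * ‖u‖ ^ 2) := by ring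
      linarith
  · refine ⟨c, r, hr, hc, hHc, ?_⟩
    rcases h with h | h
    -- The inner side of the sphere misses the origin, since `‖c‖ > r`.
    · have h0 : (⟨0, by simp⟩ : Hyp n) ∈ P :=
        hK (mem_thinBody_of_norm_le hf hs hL (by rw [norm_zero]; positivity))
      rw [h, Set.mem_ofPred_eq, zero_sub, norm_neg] at h0
      nlinarith [norm_nonneg c]
    · have hc0 : 0 < ‖c‖ := by
        by_contra! hle
        nlinarith [norm_nonneg c]
      -- The point at Euclidean distance `s / 4` from the origin towards `c` gives `r + s / 4 ≤
      -- ‖c‖`; squaring bounds `r`.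
      obtain ⟨x, hx, hxv⟩ := hmem c (norm_pos_iff.1 hc0) 1 (by simp)
      rw [h, Set.mem_ofPred_eq] at hx
      have e : x.1 - c = (s / 4 / ‖c‖ - 1) • c := by rw [hxv, sub_smul, one_smul, one_mul]
      have hc1 : 1 ≤ ‖c‖ := by nlinarith
      have hsc : s / 4 / ‖c‖ ≤ 1 := by
        rw [div_le_one hc0]; linarith
      rw [e, norm_smul, Real.norm_eq_abs, abs_of_nonpos (by linarith), neg_sub, sub_mul,
        div_mul_cancel₀ _ hc0.ne', one_mul] at hx
      nlinarith

lemma le_minLassakWidth_thinBody {e f : EuclideanSpace ℝ (Fin n)} (he : ‖e‖ = 1) (hf : ‖f‖ = 1)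
    (hef : inner ℝ f e = (0 : ℝ)) {L s w : ℝ} (hs₀ : 0 < s) (hs : s ≤ 1) (hL : 0 < L)
    (hL₂ : 2 ≤ Real.cosh L) (hw : 0 ≤ w) (hLw : Real.cosh w ≤ s / 4 * Real.cosh L) :
    w ≤ minLassakWidth (thinBody f L s) := by
  obtain ⟨H₀, hH₀⟩ := exists_isSupporting_thinBody he hef hs₀.le hL
  refine le_csInf ⟨_, H₀, hH₀, rfl⟩ ?_
  rintro _ ⟨H, hH, rfl⟩
  obtain ⟨c, r, hr, hc, hHc, hrs⟩ := exists_sphere_of_isSupporting hf hs₀ hs hL₂ hH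
  have hp : ∃ p ∈ thinBody f L s, timeCoord p = Real.cosh L ∧ inner ℝ (spaceCoord p) c ≤ 0 := by
    have hS := Real.sinh_pos_iff.2 hL
    rcases le_total (inner ℝ e c) 0 with h | h
    · obtain ⟨p, hp, ht, hv⟩ := exists_tip he hef (L := L) hs₀.le
      refine ⟨p, hp, ht, ?_⟩
      rw [hv, real_inner_smul_left]
      exact mul_nonpos_of_nonneg_of_nonpos hS.le h
    · obtain ⟨p, hp, ht, hv⟩ := exists_tip (e := -e) (f := f) (by rwa [norm_neg])
        (by rw [inner_neg_right, hef, neg_zero]) (L := L) hs₀.le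
      refine ⟨p, hp, ht, ?_⟩
      rw [hv, real_inner_smul_left, inner_neg_left]
      nlinarith
  obtain ⟨p, hpK, ht, hpc⟩ := hp
  refine le_trans ?_ (le_csSup (bddAbove_hdistSet_thinBody hH.2.1) ⟨p, hpK, rfl⟩)
  obtain ⟨y₀, hy₀, -⟩ := hH.2.1
  refine le_csInf ⟨_, y₀, hy₀, rfl⟩ ?_
  rintro _ ⟨y, hy, rfl⟩
  refine le_hdist_of_cosh_le hw ?_
  have h := timeCoord_le_mul_cosh_hdist hr hc hpc (hHc ▸ hy)
  rw [← cosh_hdist]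
  rw [ht] at h
  have h3 : s / 4 * Real.cosh L ≤ s / 4 * (r * Real.cosh (hdist p y)) := by gcongr
  have h4 : r * (s / 4) * Real.cosh (hdist p y) ≤ 1 * Real.cosh (hdist p y) := by
    gcongr
  linarith

lemma exists_cosh_ge (a : ℝ) : ∃ L, 0 < L ∧ a ≤ Real.cosh L := by
  refine ⟨max a 1, by positivity, (le_max_left a 1).trans ?_⟩
  exact (Real.self_le_sinh_iff.2 (by positivity)).trans (Real.sinh_lt_cosh _).le

end PoincareBall

end

theorem corollary3p3 (n : ℕ) (hn : 2 ≤ n) (w : ℝ) (hw : 0 < w) :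
    IsGLB {ρ : ℝ | ∃ K : Set (PoincareBall.Hyp n), PoincareBall.IsConvexBody K ∧
      w ≤ PoincareBall.minLassakWidth K ∧ ρ = PoincareBall.inradius K} 0 := by
  refine ⟨?_, fun b hb => ?_⟩
  · rintro _ ⟨K, -, -, rfl⟩
    exact PoincareBall.inradius_nonneg K
  · refine le_of_forall_pos_le_add fun ε hε => ?_
    let e : EuclideanSpace ℝ (Fin n) := EuclideanSpace.single ⟨0, by omega⟩ 1
    let f : EuclideanSpace ℝ (Fin n) := EuclideanSpace.single ⟨1, by omega⟩ 1
    have he : ‖e‖ = 1 := by simp [e]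
    have hf : ‖f‖ = 1 := by simp [f]
    have hef : inner ℝ f e = (0 : ℝ) := by simp [e, f, EuclideanSpace.inner_single_left]
    set s := min ε 1 with hsdef
    have hs₀ : 0 < s := lt_min hε one_pos
    have hs : s ≤ 1 := min_le_right _ _
    -- `L` is chosen after `s`: the bound 2 fits the small ball inside the body, the other forces
    -- width at least `w`.
    obtain ⟨L, hL, hLc⟩ := PoincareBall.exists_cosh_ge (max 2 (Real.cosh w / (s / 4)))
    have hLw : Real.cosh w ≤ s / 4 * Real.cosh L := by
      have := (le_max_right _ _).trans hLc
      rwa [div_le_iff₀' (by positivity)] at this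
    have hL₂ := (le_max_left _ _).trans hLc
    have h := hb ⟨PoincareBall.thinBody f L s, PoincareBall.isConvexBody_thinBody hf hs₀ hs hL₂,
      PoincareBall.le_minLassakWidth_thinBody he hf hef hs₀ hs hL hL₂ hw.le hLw, rfl⟩
    rw [zero_add]
    exact h.trans ((PoincareBall.inradius_thinBody_le hf hs₀.le).trans (min_le_left _ _))
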